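/- Let $d,M\ge 0$ be integers and let $\mathbf H(\lambda)=H_0+\sum_{k=1}^M\lambda_kH_k$ ($\lambda\in\mathbb R^M$) be a Hamiltonian model with self-adjoint $H_0,\dots,H_M\in\mathrm{Mat}_d(\mathbb C)$; write $\mathbf H_L(\lambda)=\sum_k\lambda_kH_k$. Let $\mathrm{Coeff}(\mathbf H)$ be either $\mathbf H(\beta)$ for an affine basis $\beta$ of $\mathbb R^M$, or $\mathbf H_L(\beta_*)\cup\mathbf H(\beta\setminus\beta_*)$ for an affine basis $\beta$ of $\mathbb R^M$ and a linear basis $\beta_*\subset\beta$ (for instance $\mathrm{Coeff}(\mathbf H)=\{H_0,\dots,H_M\}$). Let $\mathcal A(\mathbf H)\subseteq\mathrm{Mat}_d(\mathbb C)$ be the unital complex algebra generated by $\mathrm{Coeff}(\mathbf H)$. Let $|\psi_0\rangle\in\mathbb C^d$ be any vector (for instance a normalized state) and let $\mathcal A(\mathbf H)\cdot|\psi_0\rangle=\{A|\psi_0\rangle : A\in\mathcal A(\mathbf H)\}$. Then: (a) $\mathcal A(\mathbf H)\cdot|\psi_0\rangle$ is the smallest subspace of $\mathbb C^d$ that contains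 $|\psi_0\rangle$ and is invariant under $\mathbf H(\lambda)$ for all $\lambda\in\mathbb R^M$. (b) There are $m\ge 0$, integers $q_k,j_k\ge1$ ($1\le k\le m$) with $d=\sum_k j_kq_k$, and a unitary $U\in\mathrm{Mat}_d(\mathbb C)$ such that $$U\,\mathcal A(\mathbf H)\,U^\dagger=\bigoplus_{k=1}^m\mathrm{Mat}_{q_k}(\mathbb C)\otimes 1_{j_k}:=\Big\{\bigoplus_{k=1}^m\underbrace{X_k\oplus\cdots\oplus X_k}_{j_k\text{ times}} : X_k\in\mathrm{Mat}_{q_k}(\mathbb C)\Big\}.\qquad(*)$$ (c) For all $m,q_k,j_k,U$ as in (b), $m$ is the dimension of the centre of $\mathcal A(\mathbf H)$. Moreover, put $J_0=0$, $J_k=j_1+\cdots+j_k$, split $|\nu\rangle=U|\psi_0\rangle$ into consecutive subvectors $|\nu_1\rangle,\dots,|\nu_{J_m}\rangle$ with $|\nu_\alpha\rangle\in\mathbb C^{q_k}$ for $J_{k-1}<\alpha\le J_k$, and let $M_k=[\,|\nu_{J_{k-1}+1}\rangle\ \cdots\ |\nu_{J_k}\rangle\,]\in\mathrm{Mat}_{q_k\times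 j_k}(\mathbb C)$. Then $$\dim\big(\mathcal A(\mathbf H)\cdot|\psi_0\rangle\big)=\sum_{k=1}^m q_k\,\mathrm{rank}(M_k).$$ -/

import Mathlib

open scoped Matrix Kronecker

/-- A time-independent Hamiltonian model with `M` free linear parameters on `ℂ^d`: self-adjoint
operators `H_0` (`free`) and `H_1, …, H_M` (`term`). -/
structure HamiltonianModel (d M : ℕ) where
  free : Matrix (Fin d) (Fin d) ℂ
  term : Fin M → Matrix (Fin d) (Fin d) ℂ
  free_isHermitian : free.IsHermitian
  term_isHermitian : ∀ k, (term k).IsHermitian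

namespace HamiltonianModel

variable {d M : ℕ}

/-- The linear part `∑ k, l_k H_k` of the model. -/
noncomputable def linearPart (H : HamiltonianModel d M) (l : Fin M → ℝ) :
    Matrix (Fin d) (Fin d) ℂ :=
  ∑ k, (l k : ℂ) • H.term k

/-- The Hamiltonian `H(l) = H_0 + ∑ k, l_k H_k` at the real parameter value `l`. -/
noncomputable def value (H : HamiltonianModel d M) (l : Fin M → ℝ) :
    Matrix (Fin d) (Fin d) ℂ :=
  H.free + H.linearPart l

/-- `S` is an admissible collection `Coeff(H)`: either the image under `l ↦ H(l)` of an affine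
basis `b` of `ℝ^M`, or, when the points of `b` other than `b i₀` form a linear basis of `ℝ^M`,
the images of those points under the linear part of `H` together with `H(b i₀)`.
The set `{H_0, H_1, …, H_M}` is of the second kind. -/
def IsCoeff (H : HamiltonianModel d M) (S : Set (Matrix (Fin d) (Fin d) ℂ)) : Prop :=
  (∃ b : AffineBasis (Fin (M + 1)) ℝ (Fin M → ℝ), S = Set.range fun i => H.value (b i)) ∨
  (∃ (b : AffineBasis (Fin (M + 1)) ℝ (Fin M → ℝ)) (i₀ : Fin (M + 1)),
    LinearIndependent ℝ (fun i : {i // i ≠ i₀} => b i) ∧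
    S = insert (H.value (b i₀)) (Set.range fun i : {i // i ≠ i₀} => H.linearPart (b i)))

/-- `V` is invariant under `H(l)` for all parameter values `l`. -/
def IsInvariant (H : HamiltonianModel d M) (V : Submodule ℂ (Fin d → ℂ)) : Prop :=
  ∀ l : Fin M → ℝ, ∀ v ∈ V, H.value l *ᵥ v ∈ V

end HamiltonianModel

/-- The operator algebra `A(S)`: all noncommutative polynomials (constants included) in the
elements of `S`. -/
noncomputable def opAlgebra {d : ℕ} (S : Set (Matrix (Fin d) (Fin d) ℂ)) :
    Subalgebra ℂ (Matrix (Fin d) (Fin d) ℂ) :=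
  Algebra.adjoin ℂ S

/-- The orbit `A · φ = {A φ | A ∈ 𝒜}` of a vector under a matrix algebra. -/
def orbit {d : ℕ} (𝒜 : Subalgebra ℂ (Matrix (Fin d) (Fin d) ℂ)) (φ : Fin d → ℂ) :
    Submodule ℂ (Fin d → ℂ) where
  carrier := {v | ∃ A ∈ 𝒜, A *ᵥ φ = v}
  add_mem' := by
    rintro _ _ ⟨A, hA, rfl⟩ ⟨B, hB, rfl⟩
    exact ⟨A + B, 𝒜.add_mem hA hB, Matrix.add_mulVec A B φ⟩
  zero_mem' := ⟨0, 𝒜.zero_mem, Matrix.zero_mulVec φ⟩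
  smul_mem' := by
    rintro c _ ⟨A, hA, rfl⟩
    exact ⟨c • A, 𝒜.smul_mem hA c, Matrix.smul_mulVec c A φ⟩

/-- The identification of `{1, …, d}` with triples (block `k`, copy `a`, position `b`), listed
lexicographically, when `d = ∑ k, j_k q_k`. -/
def blockEquiv {d m : ℕ} (q j : Fin m → ℕ) (hd : ∑ k, j k * q k = d) :
    (Σ k : Fin m, Fin (j k) × Fin (q k)) ≃ Fin d :=
  ((Equiv.sigmaCongrRight fun _ => finProdFinEquiv).trans finSigmaFinEquiv).trans (finCongr hd)

/-- The block-diagonal `d × d` matrix `⊕_k (X_k ⊕ ⋯ ⊕ X_k)`, with `X_k` repeated `j_k` times. -/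
def blockMatrix {d m : ℕ} (q j : Fin m → ℕ) (hd : ∑ k, j k * q k = d)
    (X : ∀ k, Matrix (Fin (q k)) (Fin (q k)) ℂ) : Matrix (Fin d) (Fin d) ℂ :=
  Matrix.reindex (blockEquiv q j hd) (blockEquiv q j hd)
    (Matrix.blockDiagonal' fun k => (1 : Matrix (Fin (j k)) (Fin (j k)) ℂ) ⊗ₖ X k)

/-- A full decomposition of a matrix algebra `𝒜`: a unitary `U` with
`U 𝒜 U† = ⊕_{k=1}^m Mat_{q_k} ⊗ 1_{j_k}`, all `q_k, j_k ≥ 1`. -/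
structure FullDecomposition {d : ℕ} (𝒜 : Subalgebra ℂ (Matrix (Fin d) (Fin d) ℂ)) where
  m : ℕ
  q : Fin m → ℕ
  j : Fin m → ℕ
  q_pos : ∀ k, 0 < q k
  j_pos : ∀ k, 0 < j k
  dim_eq : ∑ k, j k * q k = d
  U : Matrix (Fin d) (Fin d) ℂ
  U_mem : U ∈ Matrix.unitaryGroup (Fin d) ℂ
  conj_eq : {B | ∃ A ∈ 𝒜, B = U * A * Uᴴ} = Set.range (blockMatrix q j dim_eq)

/-- The `q_k × j_k` matrix `M_k` whose `a`-th column is the `a`-th subvector (of length `q_k`) of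
the `k`-th part of `ν = U ψ`. -/
def FullDecomposition.stateMatrix {d : ℕ} {𝒜 : Subalgebra ℂ (Matrix (Fin d) (Fin d) ℂ)}
    (D : FullDecomposition 𝒜) (ψ : Fin d → ℂ) (k : Fin D.m) :
    Matrix (Fin (D.q k)) (Fin (D.j k)) ℂ :=
  Matrix.of fun b a => (D.U *ᵥ ψ) (blockEquiv D.q D.j D.dim_eq ⟨k, (a, b)⟩)

/-!
The elements of `S` are values of the model or linear parts, that is differences of two values, and
every value of the model is a real linear combination of elements of `S`; so `S` and the set of all
values `H(l)` generate the same algebra `𝒜` (`HamiltonianModel.IsCoeff.opAlgebra_eq`). A subspace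
invariant under all `H(l)` is invariant under `𝒜`, which makes the orbit of a vector the least such
subspace containing it.

Since the values are Hermitian, `𝒜` is closed under adjoints, so `ℂ^d` is a star representation of
`𝒜` and splits into pairwise orthogonal irreducible constituents
(`IsStarRepresentation.exists_orthogonal_simple`). By Schur's lemma isomorphic constituents are
unitarily equivalent (`IsStarRepresentation.exists_isometry_of_equiv`). Transporting an
orthonormal basis from one constituent of each isomorphism class to the others gives an
orthonormal basis of `ℂ^d` in which elements of `𝒜` have the form `⊕_k 1 ⊗ X_k`, while
intertwiners have the form `⊕_k C_k ⊗ 1`, again by Schur's lemma. Hence every operator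
`⊕_k 1 ⊗ X_k` commutes with all intertwiners and lies in `𝒜` by the Jacobson density theorem
(`IsStarRepresentation.exists_smul_iff_blockDiagonal`).

Given any full decomposition, `𝒜` is isomorphic to `∏_k Mat_{q_k}`, whose centre is `ℂ^m`. Written
in blocks, `A ψ` becomes the family `(X_k M_k)_k`, so the orbit is isomorphic to the product of the
ranges of the maps `X_k ↦ X_k M_k`. Such a map acts on the `q_k` rows of `X_k` separately, whence
its rank is `q_k * rank M_k`.
-/

open scoped InnerProductSpace

/-! ### Star representations: complete reducibility and unitary equivalence -/

/-- The action of the star ring `A` on the complex inner product space `E` carries the star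
operation to the adjoint. -/
class IsStarRepresentation (A E : Type*) [Star A] [SMul A E] [NormedAddCommGroup E]
    [InnerProductSpace ℂ E] : Prop where
  inner_smul_left (a : A) (x y : E) : ⟪a • x, y⟫_ℂ = ⟪x, star a • y⟫_ℂ

namespace IsStarRepresentation

variable {A E F : Type*} [Ring A] [StarRing A] [Algebra ℂ A]
  [NormedAddCommGroup E] [InnerProductSpace ℂ E] [Module A E] [IsScalarTower ℂ A E]
  [IsStarRepresentation A E]
  [NormedAddCommGroup F] [InnerProductSpace ℂ F] [Module A F] [IsScalarTower ℂ A F]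
  [IsStarRepresentation A F]

omit [Algebra ℂ A] [IsScalarTower ℂ A E] in
theorem inner_smul_right (a : A) (x y : E) : ⟪x, a • y⟫_ℂ = ⟪star a • x, y⟫_ℂ := by
  rw [inner_smul_left, star_star]

instance (N : Submodule A E) : IsStarRepresentation A (N.restrictScalars ℂ) where
  inner_smul_left a x y := inner_smul_left a (x : E) (y : E)

/-- The orthogonal complement of a subrepresentation, as a subrepresentation. -/
noncomputable def orthogonal (N : Submodule A E) : Submodule A E where
  __ := (N.restrictScalars ℂ)ᗮ
  smul_mem' a x hx := by
    change a • x ∈ (N.restrictScalars ℂ)ᗮ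
    change x ∈ (N.restrictScalars ℂ)ᗮ at hx
    rw [Submodule.mem_orthogonal] at hx ⊢
    intro u hu
    rw [inner_smul_right]
    exact hx _ (N.smul_mem _ hu)

theorem mem_orthogonal {N : Submodule A E} {x : E} :
    x ∈ orthogonal N ↔ ∀ u ∈ N, ⟪u, x⟫_ℂ = 0 :=
  Submodule.mem_orthogonal (N.restrictScalars ℂ) x

section FiniteDimensional

variable [FiniteDimensional ℂ E] [FiniteDimensional ℂ F]

theorem isCompl_orthogonal (N : Submodule A E) : IsCompl N (orthogonal N) := by
  have h := (Submodule.isCompl_orthogonal (K := N.restrictScalars ℂ))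
  constructor
  · rw [Submodule.disjoint_def]
    exact fun x hx hx' => Submodule.disjoint_def.1 h.disjoint x hx hx'
  · rw [codisjoint_iff, eq_top_iff]
    intro x _
    obtain ⟨y, hy, z, hz, hyz⟩ := Submodule.mem_sup.1 (h.sup_eq_top.ge (Submodule.mem_top (x := x)))
    exact Submodule.mem_sup.2 ⟨y, hy, z, hz, hyz⟩

/-- A finite-dimensional star representation is completely reducible. -/
theorem isSemisimpleModule : IsSemisimpleModule A E :=
  (isSemisimpleModule_iff A E).2 ⟨fun N => ⟨orthogonal N, isCompl_orthogonal N⟩⟩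

/-- `ℂ`-dimension bounds the length of chains of `A`-submodules. -/
theorem isArtinian (A E : Type*) [Ring A] [Algebra ℂ A]
    [NormedAddCommGroup E] [InnerProductSpace ℂ E] [Module A E] [IsScalarTower ℂ A E]
    [FiniteDimensional ℂ E] : IsArtinian A E :=
  isArtinian_of_tower ℂ inferInstance

/-- Every subrepresentation is the sum of finitely many pairwise orthogonal irreducible ones. -/
theorem exists_orthogonal_simple (N : Submodule A E) :
    ∃ s : Finset (Submodule A E), (∀ P ∈ s, IsSimpleModule A P) ∧
      (∀ P ∈ s, ∀ Q ∈ s, P ≠ Q → P ≤ orthogonal Q) ∧ s.sup id = N := by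
  classical
  have := isArtinian A E
  induction N using WellFoundedLT.induction with
  | ind N ih =>
    by_cases hN : N = ⊥
    · exact ⟨∅, by simp, by simp, by simp [hN]⟩
    obtain ⟨P, hP, hPN⟩ := (eq_bot_or_exists_atom_le N).resolve_left hN
    -- Split off an irreducible `P ≤ N` and decompose its orthogonal complement within `N`.
    have hlt : N ⊓ orthogonal P < N := by
      refine lt_of_le_of_ne inf_le_left fun h => hP.1 ?_
      have h1 : P ≤ orthogonal P := hPN.trans (inf_eq_left.1 h)
      exact (isCompl_orthogonal P).disjoint.eq_bot_of_le h1
    obtain ⟨s, hs, ho, hsup⟩ := ih _ hlt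
    have hle : ∀ Q ∈ s, Q ≤ orthogonal P := fun Q hQ =>
      (Finset.le_sup (f := id) hQ).trans (hsup.le.trans inf_le_right)
    have hsymm : ∀ Q ∈ s, P ≤ orthogonal Q := fun Q hQ x hx =>
      mem_orthogonal.2 fun u hu => inner_eq_zero_symm.1 (mem_orthogonal.1 (hle Q hQ hu) x hx)
    refine ⟨insert P s, ?_, ?_, ?_⟩
    · intro Q hQ
      rcases Finset.mem_insert.1 hQ with rfl | hQ
      · exact isSimpleModule_iff_isAtom.2 hP
      · exact hs Q hQ
    · intro Q hQ R hR hne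
      rcases Finset.mem_insert.1 hQ with rfl | hQ' <;> rcases Finset.mem_insert.1 hR with rfl | hR'
      · exact absurd rfl hne
      · exact hsymm R hR'
      · exact hle Q hQ'
      · exact ho Q hQ' R hR' hne
    · rw [Finset.sup_insert, hsup, id, inf_comm N, ← sup_inf_assoc_of_le _ hPN,
        (isCompl_orthogonal P).sup_eq_top, top_inf_eq]

/-- The adjoint of an intertwiner, as an intertwiner. -/
noncomputable def adjointHom (f : E →ₗ[A] F) : F →ₗ[A] E where
  toFun := LinearMap.adjoint (f.restrictScalars ℂ)
  map_add' := map_add _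
  map_smul' a x := by
    refine ext_inner_right ℂ fun y => ?_
    simp [LinearMap.adjoint_inner_left, inner_smul_left]

theorem adjointHom_inner_right (f : E →ₗ[A] F) (x : E) (y : F) :
    ⟪x, adjointHom f y⟫_ℂ = ⟪f x, y⟫_ℂ :=
  LinearMap.adjoint_inner_right (f.restrictScalars ℂ) x y

/-- Isomorphic irreducible star representations are unitarily equivalent: by Schur's lemma
`f† f` is a scalar, which is positive, so a multiple of `f` is isometric. -/
theorem exists_isometry_of_equiv [IsSimpleModule A E] (f : E ≃ₗ[A] F) :
    ∃ g : E ≃ₗᵢ[ℂ] F, ∀ (a : A) (x : E), g (a • x) = a • g x := by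
  obtain ⟨c, hc⟩ := (IsSimpleModule.algebraMap_end_bijective_of_isAlgClosed (A := A) (V := E) ℂ).2
    (adjointHom f.toLinearMap ∘ₗ f.toLinearMap)
  have key : ∀ x y : E, ⟪f x, f y⟫_ℂ = c * ⟪x, y⟫_ℂ := by
    intro x y
    have h := congr(⟪x, $hc y⟫_ℂ)
    simp only [Module.algebraMap_end_apply, _root_.inner_smul_right, LinearMap.comp_apply,
      adjointHom_inner_right] at h
    exact h.symm
  have := IsSimpleModule.nontrivial A E
  obtain ⟨x₀, hx₀⟩ := exists_ne (0 : E)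
  have hfx : f x₀ ≠ 0 := by simpa using hx₀
  -- `c` is the real number `(‖f x₀‖ / ‖x₀‖) ^ 2`, so `f` scales all norms by `t`.
  set t : ℝ := ‖f x₀‖ / ‖x₀‖ with ht
  have ht0 : 0 < t := div_pos (norm_pos_iff.2 hfx) (norm_pos_iff.2 hx₀)
  have hct : c = ((t ^ 2 : ℝ) : ℂ) := by
    have h := key x₀ x₀
    rw [inner_self_eq_norm_sq_to_K, inner_self_eq_norm_sq_to_K] at h
    have hne : ((‖x₀‖ : ℝ) : ℂ) ≠ 0 := by exact_mod_cast (norm_pos_iff.2 hx₀).ne'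
    rw [ht]
    push_cast
    rw [div_pow]
    field_simp
    exact h.symm
  have hnorm : ∀ x, ‖f x‖ = t * ‖x‖ := by
    intro x
    have h := key x x
    rw [inner_self_eq_norm_sq_to_K, inner_self_eq_norm_sq_to_K, hct] at h
    have h' : ‖f x‖ ^ 2 = (t * ‖x‖) ^ 2 := by
      apply Complex.ofReal_injective
      push_cast at h ⊢
      rw [mul_pow]
      exact h
    exact (sq_eq_sq₀ (norm_nonneg _) (by positivity)).1 h'
  have htc : ((t⁻¹ : ℝ) : ℂ) ≠ 0 := by exact_mod_cast inv_ne_zero ht0.ne'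
  refine ⟨⟨(f.restrictScalars ℂ).trans (LinearEquiv.smulOfNeZero ℂ F _ htc), fun x => ?_⟩,
    fun a x => ?_⟩
  · simp [norm_smul, hnorm, abs_of_pos ht0, ht0.ne']
  · change ((t⁻¹ : ℝ) : ℂ) • f (a • x) = a • ((t⁻¹ : ℝ) : ℂ) • f x
    rw [map_smul, ← algebraMap_smul A ((t⁻¹ : ℝ) : ℂ) (f x),
      ← algebraMap_smul A ((t⁻¹ : ℝ) : ℂ) (a • f x), ← mul_smul, ← mul_smul, Algebra.commutes]

end FiniteDimensional

end IsStarRepresentation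

/-! ### Block form of a star representation -/

namespace IsStarRepresentation

section Blocks

variable {A E : Type*} [Ring A] [StarRing A] [Algebra ℂ A]
  [NormedAddCommGroup E] [InnerProductSpace ℂ E] [Module A E] [IsScalarTower ℂ A E]
  [IsStarRepresentation A E] [FiniteDimensional ℂ E]
  {κ : Type*} [Fintype κ] [DecidableEq κ] {α β : κ → Type*}
  [∀ k, Fintype (α k)] [∀ k, DecidableEq (α k)] [∀ k, Fintype (β k)] [∀ k, DecidableEq (β k)]
  {F : κ → Type*} [∀ k, NormedAddCommGroup (F k)] [∀ k, InnerProductSpace ℂ (F k)]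
  [∀ k, Module A (F k)] [∀ k, IsScalarTower ℂ A (F k)] [∀ k, IsStarRepresentation A (F k)]
  [∀ k, FiniteDimensional ℂ (F k)] [∀ k, IsSimpleModule A (F k)]

omit [StarRing A] [IsStarRepresentation A E] [∀ k, IsStarRepresentation A (F k)]
  [∀ k, IsSimpleModule A (F k)] in
/-- In a basis adapted to copies `φ k a` of representations `F k`, the elements of `A` act by
matrices of the form `⊕_k 1 ⊗ X_k`. -/
theorem toMatrixOrthonormal_smul
    (w : OrthonormalBasis (Σ k, α k × β k) ℂ E) (e : ∀ k, OrthonormalBasis (β k) ℂ (F k))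
    (φ : ∀ k, α k → F k →ₗ[A] E) (hw : ∀ k a b, w ⟨k, (a, b)⟩ = φ k a (e k b)) (x : A) :
    LinearMap.toMatrixOrthonormal w (Module.toModuleEnd ℂ E x) =
      Matrix.blockDiagonal' fun k => (1 : Matrix (α k) (α k) ℂ) ⊗ₖ
        LinearMap.toMatrixOrthonormal (e k) (Module.toModuleEnd ℂ (F k) x) := by
  ext ⟨k', a', b'⟩ ⟨k, a, b⟩
  have hx : x • w ⟨k, (a, b)⟩ = ∑ c, ⟪e k c, x • e k b⟫_ℂ • w ⟨k, (a, c)⟩ := by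
    have h : φ k a (∑ c, ⟪e k c, x • e k b⟫_ℂ • e k c) = φ k a (x • e k b) :=
      congrArg _ ((e k).sum_repr' _)
    rw [hw, ← map_smul, ← h, map_sum]
    refine Finset.sum_congr rfl fun c _ => ?_
    rw [hw]
    exact (φ k a).map_smul_of_tower _ _
  rw [LinearMap.toMatrixOrthonormal_apply_apply, Module.toModuleEnd_apply,
    DistribSMul.toLinearMap_apply, hx, inner_sum]
  simp only [_root_.inner_smul_right, orthonormal_iff_ite.1 w.orthonormal]
  by_cases hk : k' = k
  · subst hk
    rw [Matrix.blockDiagonal'_apply_eq]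
    simp only [Matrix.kroneckerMap_apply, LinearMap.toMatrixOrthonormal_apply_apply,
      Matrix.one_apply]
    by_cases ha : a' = a <;> simp [ha]
  · rw [Matrix.blockDiagonal'_apply_ne _ _ _ hk]
    simp [hk]

/-- In a basis adapted to copies of pairwise non-isomorphic irreducible representations, Schur's
lemma forces intertwiners to have matrices of the form `⊕_k C_k ⊗ 1`. -/
theorem exists_toMatrixOrthonormal_intertwiner
    (w : OrthonormalBasis (Σ k, α k × β k) ℂ E) (e : ∀ k, OrthonormalBasis (β k) ℂ (F k))
    (φ : ∀ k, α k → F k →ₗ[A] E) (hw : ∀ k a b, w ⟨k, (a, b)⟩ = φ k a (e k b))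
    (hF : ∀ k l, k ≠ l → IsEmpty (F k ≃ₗ[A] F l)) (g : E →ₗ[A] E) :
    ∃ C : ∀ k, Matrix (α k) (α k) ℂ, LinearMap.toMatrixOrthonormal w (g.restrictScalars ℂ) =
      Matrix.blockDiagonal' fun k => C k ⊗ₖ (1 : Matrix (β k) (β k) ℂ) := by
  have key : ∀ k' a' b' k a b, ⟪w ⟨k', (a', b')⟩, g (w ⟨k, (a, b)⟩)⟫_ℂ =
      ⟪e k' b', (adjointHom (φ k' a') ∘ₗ g ∘ₗ φ k a) (e k b)⟫_ℂ := by
    intro k' a' b' k a b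
    rw [hw, hw, LinearMap.comp_apply, LinearMap.comp_apply, adjointHom_inner_right]
  have hC : ∀ k (a' a : α k), ∃ c : ℂ, algebraMap ℂ (Module.End A (F k)) c =
      adjointHom (φ k a') ∘ₗ g ∘ₗ φ k a := fun k a' a =>
    (IsSimpleModule.algebraMap_end_bijective_of_isAlgClosed (A := A) (V := F k) ℂ).2 _
  choose C hC using hC
  refine ⟨fun k => Matrix.of (C k), ?_⟩
  ext ⟨k', a', b'⟩ ⟨k, a, b⟩
  rw [LinearMap.toMatrixOrthonormal_apply_apply, LinearMap.restrictScalars_apply, key]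
  by_cases hk : k' = k
  · subst hk
    rw [Matrix.blockDiagonal'_apply_eq, ← hC]
    simp [orthonormal_iff_ite.1 (e k').orthonormal, Matrix.one_apply]
  · rw [Matrix.blockDiagonal'_apply_ne _ _ _ hk]
    have h0 : adjointHom (φ k' a') ∘ₗ g ∘ₗ φ k a = 0 :=
      (LinearMap.bijective_or_eq_zero _).resolve_left fun h =>
        (hF k k' (Ne.symm hk)).false (LinearEquiv.ofBijective _ h)
    rw [h0, LinearMap.zero_apply, inner_zero_right]

/-- The action of `A` fills out all matrices of the form `⊕_k 1 ⊗ X_k`: they commute with the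
intertwiners, so the Jacobson density theorem applies to them. -/
theorem exists_smul_iff_blockDiagonal
    (w : OrthonormalBasis (Σ k, α k × β k) ℂ E) (e : ∀ k, OrthonormalBasis (β k) ℂ (F k))
    (φ : ∀ k, α k → F k →ₗ[A] E) (hw : ∀ k a b, w ⟨k, (a, b)⟩ = φ k a (e k b))
    (hF : ∀ k l, k ≠ l → IsEmpty (F k ≃ₗ[A] F l)) (f : Module.End ℂ E) :
    (∃ x : A, Module.toModuleEnd ℂ E x = f) ↔
      ∃ X : ∀ k, Matrix (β k) (β k) ℂ, LinearMap.toMatrixOrthonormal w f =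
        Matrix.blockDiagonal' fun k => (1 : Matrix (α k) (α k) ℂ) ⊗ₖ X k := by
  constructor
  · rintro ⟨x, rfl⟩
    exact ⟨_, toMatrixOrthonormal_smul w e φ hw x⟩
  rintro ⟨X, hX⟩
  -- `1 ⊗ X_k` and `C_k ⊗ 1` commute.
  have hcomm : ∀ g : Module.End A E, f * g.restrictScalars ℂ = g.restrictScalars ℂ * f := by
    intro g
    obtain ⟨C, hC⟩ := exists_toMatrixOrthonormal_intertwiner w e φ hw hF g
    apply EquivLike.injective (LinearMap.toMatrixOrthonormal w)
    rw [map_mul, map_mul, hX, hC, ← Matrix.blockDiagonal'_mul, ← Matrix.blockDiagonal'_mul]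
    simp only [← Matrix.mul_kronecker_mul, one_mul, mul_one]
  have : IsSemisimpleModule A E := isSemisimpleModule
  classical
  obtain ⟨x, hx⟩ := jacobson_density (R := A)
    ({ f with map_smul' := fun g y => congr($(hcomm g) y) } : Module.End (Module.End A E) E)
    (Finset.univ.image w)
  refine ⟨x, w.toBasis.ext fun i => ?_⟩
  simpa using (hx (w i) (Finset.mem_image_of_mem _ (Finset.mem_univ i))).symm

end Blocks

section Decomposition

variable (A E : Type*) [Ring A] [StarRing A] [Algebra ℂ A]
  [NormedAddCommGroup E] [InnerProductSpace ℂ E] [Module A E] [IsScalarTower ℂ A E]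
  [IsStarRepresentation A E] [FiniteDimensional ℂ E]

/-- A finite-dimensional star representation has an orthonormal basis in which the operators coming
from `A` are exactly the matrices of the form `⊕_k 1 ⊗ X_k`. -/
theorem exists_orthonormalBasis_blockDiagonal :
    ∃ (m : ℕ) (q j : Fin m → ℕ) (_ : ∀ k, 0 < q k) (_ : ∀ k, 0 < j k)
      (w : OrthonormalBasis (Σ k, Fin (j k) × Fin (q k)) ℂ E),
      ∀ f : Module.End ℂ E, (∃ x : A, Module.toModuleEnd ℂ E x = f) ↔
        ∃ X : ∀ k, Matrix (Fin (q k)) (Fin (q k)) ℂ, LinearMap.toMatrixOrthonormal w f =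
          Matrix.blockDiagonal' fun k => (1 : Matrix (Fin (j k)) (Fin (j k)) ℂ) ⊗ₖ X k := by
  classical
  obtain ⟨s, hs, ho, hsup⟩ := exists_orthogonal_simple (⊤ : Submodule A E)
  let V : s → Submodule ℂ E := fun i => i.1.restrictScalars ℂ
  have hsimple : ∀ i, IsSimpleModule A (V i) := fun i => hs i i.2
  -- The constituents are sorted into classes of isomorphic ones.
  let r : Setoid s :=
    ⟨fun i l => Nonempty (V i ≃ₗ[A] V l), fun i => ⟨.refl A _⟩, fun ⟨f⟩ => ⟨f.symm⟩,
      fun ⟨f⟩ ⟨g⟩ => ⟨f.trans g⟩⟩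
  let c : s → Fin (Fintype.card (Quotient r)) := fun i => Fintype.equivFin (Quotient r) ⟦i⟧
  let rep : Fin (Fintype.card (Quotient r)) → s := fun k =>
    ((Fintype.equivFin (Quotient r)).symm k).out
  have hc : ∀ k, c (rep k) = k := fun k => by simp [c, rep]
  have hciff : ∀ i l, c i = c l ↔ Nonempty (V i ≃ₗ[A] V l) := fun i l => by
    simp only [c, EmbeddingLike.apply_eq_iff_eq]
    exact Quotient.eq (r := r)
  have hT : ∀ k (i : {i // c i = k}), ∃ T : V (rep k) ≃ₗᵢ[ℂ] V i.1,
      ∀ (a : A) x, T (a • x) = a • T x := by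
    rintro _ ⟨i, rfl⟩
    obtain ⟨f⟩ := (hciff (rep (c i)) i).1 (hc _)
    exact exists_isometry_of_equiv f
  choose T hT using hT
  have hV : OrthogonalFamily ℂ (fun i => V i) fun i => (V i).subtypeₗᵢ := by
    intro i l hil x y
    refine inner_eq_zero_symm.1 ?_
    exact mem_orthogonal.1 (ho i i.2 l l.2 (fun h => hil (Subtype.ext h)) x.2) y y.2
  have hint : DirectSum.IsInternal V := by
    rw [hV.isInternal_iff, Submodule.eq_bot_iff]
    intro x hx
    -- If `x` is orthogonal to all constituents, so is `A • x`; then `x` is orthogonal to itself.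
    have hle : (⊤ : Submodule A E) ≤ orthogonal (Submodule.span A {x}) := by
      rw [← hsup]
      refine Finset.sup_le fun P hP y hy => mem_orthogonal.2 fun u hu => ?_
      obtain ⟨a, rfl⟩ := Submodule.mem_span_singleton.1 hu
      rw [inner_smul_left]
      refine inner_eq_zero_symm.1 ((Submodule.mem_orthogonal _ _).1 hx _ ?_)
      exact Submodule.mem_iSup_of_mem (p := V) ⟨P, hP⟩ (P.smul_mem _ hy)
    exact inner_self_eq_zero.1
      (mem_orthogonal.1 (hle (Submodule.mem_top (x := x))) x (Submodule.mem_span_singleton_self x))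
  let q : Fin (Fintype.card (Quotient r)) → ℕ := fun k => Module.finrank ℂ (V (rep k))
  let j : Fin (Fintype.card (Quotient r)) → ℕ := fun k => Fintype.card {i // c i = k}
  let e : ∀ k, OrthonormalBasis (Fin (q k)) ℂ (V (rep k)) := fun k => stdOrthonormalBasis ℂ _
  let w₀ : OrthonormalBasis (Σ i, Fin (q (c i))) ℂ E :=
    hint.collectedOrthonormalBasis hV fun i => (e (c i)).map (T (c i) ⟨i, rfl⟩)
  let copy : ∀ k, {i // c i = k} ≃ Fin (j k) := fun k => Fintype.equivFin _
  let φ : ∀ k, Fin (j k) → V (rep k) →ₗ[A] E := fun k a =>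
    { toFun := fun x => T k ((copy k).symm a) x
      map_add' := fun x y => by simp
      map_smul' := fun x y => by rw [hT]; rfl }
  -- Position `b` of the constituent `i` becomes position `b` of a copy in the block `c i`.
  let τ : (Σ i, Fin (q (c i))) → Σ k, Fin (j k) × Fin (q k) := fun p =>
    ⟨c p.1, (copy _ ⟨p.1, rfl⟩, p.2)⟩
  have hτ : ∀ p, w₀ p = φ (τ p).1 (τ p).2.1 (e (τ p).1 (τ p).2.2) := fun p => by
    change w₀ p = (T (c p.1) ((copy (c p.1)).symm (copy (c p.1) ⟨p.1, rfl⟩)) (e (c p.1) p.2) : E)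
    rw [Equiv.symm_apply_apply]
    simp [w₀, DirectSum.IsInternal.collectedOrthonormalBasis]
  have hτ_bij : Function.Bijective τ := by
    constructor
    · intro p p' h
      -- `w₀` factors through `τ`, and basis vectors are distinct.
      apply w₀.toBasis.injective
      rw [w₀.coe_toBasis, hτ, hτ, h]
    · rintro ⟨k, a, b⟩
      obtain ⟨⟨i, rfl⟩, rfl⟩ := (copy k).surjective a
      exact ⟨⟨i, b⟩, rfl⟩
  refine ⟨Fintype.card (Quotient r), q, j, fun k => ?_, fun k => ?_,
    w₀.reindex (Equiv.ofBijective τ hτ_bij), ?_⟩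
  · have := IsSimpleModule.nontrivial A (V (rep k))
    exact Module.finrank_pos
  · exact Fintype.card_pos_iff.2 ⟨⟨rep k, hc k⟩⟩
  · refine exists_smul_iff_blockDiagonal _ e φ (fun k a b => ?_) fun k l hkl => ⟨fun f => hkl ?_⟩
    · obtain ⟨p, hp⟩ := hτ_bij.2 ⟨k, (a, b)⟩
      rw [← hp, ← Equiv.ofBijective_apply τ hτ_bij, OrthonormalBasis.reindex_apply,
        Equiv.symm_apply_apply, hτ, hp]
    · have := (hciff _ _).2 ⟨f⟩
      rwa [hc, hc] at this

end Decomposition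

end IsStarRepresentation

/-! ### Existence of full decompositions -/

/-- The basis `w₀` of the auxiliary space `E` serves to let the matrices in `𝒜` act on `E`. -/
theorem FullDecomposition.nonempty_of_orthonormalBasis {d : ℕ} {E : Type*} [NormedAddCommGroup E]
    [InnerProductSpace ℂ E] [FiniteDimensional ℂ E] (w₀ : OrthonormalBasis (Fin d) ℂ E)
    (𝒜 : Subalgebra ℂ (Matrix (Fin d) (Fin d) ℂ)) (h𝒜 : ∀ A ∈ 𝒜, Aᴴ ∈ 𝒜) :
    Nonempty (FullDecomposition 𝒜) := by
  let Φ := LinearMap.toMatrixOrthonormal w₀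
  let _ : StarRing 𝒜 :=
    { star := fun A => ⟨star A.1, h𝒜 A.1 A.2⟩
      star_involutive := fun A => Subtype.ext (star_star A.1)
      star_mul := fun A B => Subtype.ext (star_mul A.1 B.1)
      star_add := fun A B => Subtype.ext (star_add A.1 B.1) }
  let _ : Module 𝒜 E := Module.compHom E
    (Φ.symm.toRingEquiv.toRingHom.comp 𝒜.val.toRingHom)
  have smul_def : ∀ (A : 𝒜) (x : E), A • x = Φ.symm (A : Matrix (Fin d) (Fin d) ℂ) x :=
    fun _ _ => rfl
  have : IsScalarTower ℂ 𝒜 E := ⟨fun c A x => by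
    rw [smul_def, smul_def, ← LinearMap.smul_apply, ← map_smul]
    rfl⟩
  have : IsStarRepresentation 𝒜 E := ⟨fun A x y => by
    have h : ((star A : 𝒜) : Matrix (Fin d) (Fin d) ℂ) = star A.1 := rfl
    rw [smul_def, smul_def, h, map_star, LinearMap.star_eq_adjoint,
      LinearMap.adjoint_inner_right]⟩
  obtain ⟨m, q, j, hq, hj, w, hw⟩ :=
    IsStarRepresentation.exists_orthonormalBasis_blockDiagonal 𝒜 E
  have hdim : ∑ k, j k * q k = d := by
    have h := Module.finrank_eq_card_basis w.toBasis
    rw [Module.finrank_eq_card_basis w₀.toBasis] at h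
    simpa using h.symm
  let w' := w.reindex (blockEquiv q j hdim)
  -- The change of coordinates from `w₀` to the adapted basis.
  let U : Matrix (Fin d) (Fin d) ℂ := w'.toBasis.toMatrix w₀
  have hU : U ∈ Matrix.unitaryGroup (Fin d) ℂ := w'.toMatrix_orthonormalBasis_mem_unitary w₀
  have hUinv : w₀.toBasis.toMatrix w' = Uᴴ := by
    have h1 : w₀.toBasis.toMatrix w' * U = 1 := by
      simpa [U] using w₀.toBasis.toMatrix_mul_toMatrix_flip w'.toBasis
    calc w₀.toBasis.toMatrix w' = w₀.toBasis.toMatrix w' * (U * Uᴴ) := by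
          rw [← Matrix.star_eq_conjTranspose, Matrix.mem_unitaryGroup_iff.1 hU, mul_one]
      _ = Uᴴ := by rw [← mul_assoc, h1, one_mul]
  have hconj : ∀ f : Module.End ℂ E, U * Φ f * Uᴴ = Matrix.reindex (blockEquiv q j hdim)
      (blockEquiv q j hdim) (LinearMap.toMatrixOrthonormal w f) := by
    intro f
    rw [← LinearMap.toMatrixOrthonormal_reindex, ← hUinv]
    have := basis_toMatrix_mul_linearMap_toMatrix_mul_basis_toMatrix
      w'.toBasis w₀.toBasis w'.toBasis w₀.toBasis f
    rw [w₀.coe_toBasis, w'.coe_toBasis] at this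
    exact this
  refine ⟨⟨m, q, j, hq, hj, hdim, U, hU, ?_⟩⟩
  ext B
  constructor
  · rintro ⟨A, hA, rfl⟩
    obtain ⟨X, hX⟩ := (hw (Φ.symm A)).1 ⟨⟨A, hA⟩, rfl⟩
    refine ⟨X, ?_⟩
    have := hconj (Φ.symm A)
    rw [StarAlgEquiv.apply_symm_apply] at this
    rw [this, hX, blockMatrix]
  · rintro ⟨X, rfl⟩
    obtain ⟨f, hf⟩ := EquivLike.surjective (LinearMap.toMatrixOrthonormal w)
      (Matrix.blockDiagonal' fun k => (1 : Matrix (Fin (j k)) (Fin (j k)) ℂ) ⊗ₖ X k)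
    obtain ⟨A, hA⟩ := (hw f).2 ⟨X, hf⟩
    refine ⟨A, A.2, ?_⟩
    have hΦ : Φ f = A := by
      rw [← hA]
      exact StarAlgEquiv.apply_symm_apply Φ A
    rw [← hΦ, hconj, hf, blockMatrix]

theorem FullDecomposition.nonempty_of_conjTranspose_mem {d : ℕ}
    (𝒜 : Subalgebra ℂ (Matrix (Fin d) (Fin d) ℂ)) (h𝒜 : ∀ A ∈ 𝒜, Aᴴ ∈ 𝒜) :
    Nonempty (FullDecomposition 𝒜) :=
  nonempty_of_orthonormalBasis (EuclideanSpace.basisFun (Fin d) ℂ) 𝒜 h𝒜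

/-! ### Dimensions of centres and ranges -/

theorem AlgEquiv.finrank_center_eq {R A B : Type*} [Field R] [Ring A] [Ring B] [Algebra R A]
    [Algebra R B] (e : A ≃ₐ[R] B) :
    Module.finrank R (Subalgebra.center R A) = Module.finrank R (Subalgebra.center R B) := by
  have h : (Subalgebra.toSubmodule (Subalgebra.center R A)).map e.toLinearEquiv.toLinearMap =
      Subalgebra.toSubmodule (Subalgebra.center R B) := by
    ext b
    constructor
    · rintro ⟨a, ha, rfl⟩
      exact (MulEquivClass.apply_mem_center_iff e).2 ha
    · intro hb
      refine ⟨e.symm b, (MulEquivClass.apply_mem_center_iff e.symm).2 hb, ?_⟩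
      simp
  exact (LinearEquiv.finrank_map_eq e.toLinearEquiv
    (Subalgebra.toSubmodule (Subalgebra.center R A))).symm.trans (by rw [h]; rfl)

theorem Matrix.finrank_center_pi {K κ : Type*} [Field K] [Fintype κ] {n : κ → Type*}
    [∀ k, Fintype (n k)] [∀ k, DecidableEq (n k)] [∀ k, Nonempty (n k)] :
    Module.finrank K (Subalgebra.center K (∀ k, Matrix (n k) (n k) K)) = Fintype.card κ := by
  let L : (κ → K) →ₗ[K] (∀ k, Matrix (n k) (n k) K) :=
    LinearMap.piMap fun k => (Algebra.linearMap K (Matrix (n k) (n k) K))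
  have hL : Function.Injective L := by
    intro c c' h
    funext k
    exact (algebraMap K (Matrix (n k) (n k) K)).injective (congrFun h k)
  have hrange : LinearMap.range L =
      Subalgebra.toSubmodule (Subalgebra.center K (∀ k, Matrix (n k) (n k) K)) := by
    ext X
    rw [Subalgebra.mem_toSubmodule, Subalgebra.center_pi]
    constructor
    · rintro ⟨c, rfl⟩ k -
      exact (Subalgebra.center K _).algebraMap_mem (c k)
    · intro hX
      have h : ∀ k, ∃ c : K, X k = algebraMap K _ c := fun k =>
        (Algebra.IsCentral.mem_center_iff K).1 (hX k trivial)
      choose c hc using h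
      exact ⟨c, funext fun k => (hc k).symm⟩
  have h := LinearMap.finrank_range_of_inj hL
  rw [hrange, Module.finrank_pi] at h
  exact h

theorem LinearMap.finrank_range_piMap {K κ : Type*} [Field K] [Fintype κ] {V W : κ → Type*}
    [∀ k, AddCommGroup (V k)] [∀ k, Module K (V k)] [∀ k, FiniteDimensional K (V k)]
    [∀ k, AddCommGroup (W k)] [∀ k, Module K (W k)] (f : ∀ k, V k →ₗ[K] W k) :
    Module.finrank K (LinearMap.range (LinearMap.piMap f)) =
      ∑ k, Module.finrank K (LinearMap.range (f k)) := by
  have hsurj : Function.Surjective (LinearMap.piMap fun k => (f k).rangeRestrict) := by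
    rw [LinearMap.coe_piMap]
    exact Function.Surjective.piMap fun k => (f k).surjective_rangeRestrict
  have hinj : Function.Injective (LinearMap.piMap fun k => (LinearMap.range (f k)).subtype) := by
    rw [LinearMap.coe_piMap]
    exact Function.Injective.piMap fun k => Subtype.val_injective
  have hcomp : LinearMap.piMap f = (LinearMap.piMap fun k => (LinearMap.range (f k)).subtype) ∘ₗ
      (LinearMap.piMap fun k => (f k).rangeRestrict) := rfl
  rw [hcomp, LinearMap.range_comp_of_range_eq_top _ (LinearMap.range_eq_top.2 hsurj),
    LinearMap.finrank_range_of_inj hinj, Module.finrank_pi_fintype]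

/-- Right multiplication acts on each of the rows separately. -/
theorem Matrix.finrank_range_mul_right {K l m n : Type*} [Field K] [Fintype l] [Fintype m]
    [Fintype n] (N : Matrix m n K) :
    Module.finrank K (LinearMap.range (mulRightLinearMap l K N)) = Fintype.card l * N.rank := by
  have h := LinearMap.finrank_range_piMap fun _ : l => N.vecMulLinear
  have hN : Module.finrank K (LinearMap.range N.vecMulLinear) = N.rank := by
    rw [← Matrix.rank_transpose, Matrix.rank, Matrix.mulVecLin_transpose]
  rw [hN, Finset.sum_const, smul_eq_mul, Finset.card_univ] at h
  exact h

/-! ### Block-diagonal matrices with repeated blocks -/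

section blockMatrix

variable {d m : ℕ} (q j : Fin m → ℕ) (hd : ∑ k, j k * q k = d)

theorem blockMatrix_apply (X : ∀ k, Matrix (Fin (q k)) (Fin (q k)) ℂ) (p p') :
    blockMatrix q j hd X (blockEquiv q j hd p) (blockEquiv q j hd p') =
      Matrix.blockDiagonal' (fun k => (1 : Matrix (Fin (j k)) (Fin (j k)) ℂ) ⊗ₖ X k) p p' := by
  simp [blockMatrix]

/-- `X ↦ ⊕_k (X_k ⊕ ⋯ ⊕ X_k)` as a homomorphism of algebras. -/
noncomputable def blockMatrixAlgHom :
    (∀ k, Matrix (Fin (q k)) (Fin (q k)) ℂ) →ₐ[ℂ] Matrix (Fin d) (Fin d) ℂ :=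
  AlgHom.ofLinearMap
    { toFun := blockMatrix q j hd
      map_add' := fun X Y => by
        simp only [blockMatrix, Pi.add_apply, Matrix.kronecker_add]
        rw [← Pi.add_def, Matrix.blockDiagonal'_add]
        rfl
      map_smul' := fun c X => by
        simp only [blockMatrix, Pi.smul_apply, Matrix.kronecker_smul]
        rw [← Pi.smul_def, Matrix.blockDiagonal'_smul]
        rfl }
    (by
      change blockMatrix q j hd 1 = 1
      simp only [blockMatrix, Pi.one_apply, Matrix.one_kronecker_one]
      rw [← Pi.one_def, Matrix.blockDiagonal'_one]
      simp)
    (fun X Y => by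
      change blockMatrix q j hd (X * Y) = blockMatrix q j hd X * blockMatrix q j hd Y
      simp only [blockMatrix, Pi.mul_apply, Matrix.reindex_apply, Matrix.submatrix_mul_equiv,
        ← Matrix.blockDiagonal'_mul, ← Matrix.mul_kronecker_mul, one_mul])

theorem blockMatrix_injective (hj : ∀ k, 0 < j k) : Function.Injective (blockMatrix q j hd) := by
  intro X Y h
  funext k
  ext b b'
  have h' := congr($h (blockEquiv q j hd ⟨k, (⟨0, hj k⟩, b)⟩)
    (blockEquiv q j hd ⟨k, (⟨0, hj k⟩, b')⟩))
  simpa [blockMatrix_apply, Matrix.blockDiagonal'_apply_eq] using h'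

/-- Each copy in block `k` of a vector is multiplied by `X k`. -/
theorem blockMatrix_mulVec (X : ∀ k, Matrix (Fin (q k)) (Fin (q k)) ℂ) (v : Fin d → ℂ) (k a b) :
    (blockMatrix q j hd X *ᵥ v) (blockEquiv q j hd ⟨k, (a, b)⟩) =
      ∑ c, X k b c * v (blockEquiv q j hd ⟨k, (a, c)⟩) := by
  rw [Matrix.mulVec, dotProduct, ← (blockEquiv q j hd).sum_comp, Fintype.sum_sigma,
    Finset.sum_eq_single k]
  · simp only [blockMatrix_apply, Matrix.blockDiagonal'_apply_eq, Fintype.sum_prod_type,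
      Matrix.kroneckerMap_apply, Matrix.one_apply]
    rw [Finset.sum_eq_single a]
    · simp
    · intro a' _ ha
      simp [ha.symm]
    · simp
  · intro k' _ hk
    refine Finset.sum_eq_zero fun p _ => ?_
    rw [blockMatrix_apply, Matrix.blockDiagonal'_apply_ne _ _ _ hk.symm, zero_mul]
  · simp

end blockMatrix

/-! ### Centre and orbits in terms of a full decomposition -/

namespace FullDecomposition

variable {d : ℕ} {𝒜 : Subalgebra ℂ (Matrix (Fin d) (Fin d) ℂ)} (D : FullDecomposition 𝒜)

theorem U_mul_conjTranspose : D.U * D.Uᴴ = 1 := Matrix.mem_unitaryGroup_iff.1 D.U_mem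

theorem conjTranspose_mul_U : D.Uᴴ * D.U = 1 := Matrix.mem_unitaryGroup_iff'.1 D.U_mem

theorem mem_iff (A : Matrix (Fin d) (Fin d) ℂ) :
    A ∈ 𝒜 ↔ ∃ X, blockMatrix D.q D.j D.dim_eq X = D.U * A * D.Uᴴ := by
  have h : D.U * A * D.Uᴴ ∈ {B | ∃ A ∈ 𝒜, B = D.U * A * D.Uᴴ} ↔ _ :=
    Set.ext_iff.1 D.conj_eq _
  refine Iff.trans ⟨fun hA => ⟨A, hA, rfl⟩, ?_⟩ h
  rintro ⟨A', hA', hAA'⟩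
  have h1 : ∀ B, D.Uᴴ * (D.U * B * D.Uᴴ) * D.U = B := fun B => by
    calc D.Uᴴ * (D.U * B * D.Uᴴ) * D.U = (D.Uᴴ * D.U) * B * (D.Uᴴ * D.U) := by
          simp only [mul_assoc]
      _ = B := by rw [conjTranspose_mul_U, one_mul, mul_one]
  rwa [← h1 A, hAA', h1]

/-- Conjugation by `U` identifies `𝒜` with a product of full matrix algebras. -/
noncomputable def algEquiv : (∀ k, Matrix (Fin (D.q k)) (Fin (D.q k)) ℂ) ≃ₐ[ℂ] 𝒜 :=
  let c := Unitary.conjStarAlgAut ℂ (Matrix (Fin d) (Fin d) ℂ) ⟨D.U, D.U_mem⟩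
  AlgEquiv.ofBijective
    ((c.symm.toAlgEquiv.toAlgHom.comp (blockMatrixAlgHom D.q D.j D.dim_eq)).codRestrict 𝒜
      fun X => (D.mem_iff _).2 ⟨X, (c.apply_symm_apply (blockMatrix D.q D.j D.dim_eq X)).symm⟩)
    ⟨fun X Y h => blockMatrix_injective D.q D.j D.dim_eq D.j_pos
        (EquivLike.injective c.symm (congrArg Subtype.val h)),
      fun A => by
        obtain ⟨X, hX⟩ := (D.mem_iff A).1 A.2
        refine ⟨X, Subtype.ext ?_⟩
        change c.symm (blockMatrix D.q D.j D.dim_eq X) = A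
        rw [hX]
        exact c.symm_apply_apply A.1⟩

theorem m_eq_finrank_center : D.m = Module.finrank ℂ (Subalgebra.center ℂ 𝒜) := by
  have : ∀ k, Nonempty (Fin (D.q k)) := fun k => ⟨⟨0, D.q_pos k⟩⟩
  rw [← D.algEquiv.finrank_center_eq, Matrix.finrank_center_pi, Fintype.card_fin]

/-- If `U A U† = ⊕_k (X_k ⊕ ⋯ ⊕ X_k)`, then `A` acts on the state matrices by left multiplication
with the `X_k`. -/
theorem stateMatrix_mulVec {A : Matrix (Fin d) (Fin d) ℂ}
    {X : ∀ k, Matrix (Fin (D.q k)) (Fin (D.q k)) ℂ}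
    (h : blockMatrix D.q D.j D.dim_eq X = D.U * A * D.Uᴴ) (ψ : Fin d → ℂ) (k : Fin D.m) :
    D.stateMatrix (A *ᵥ ψ) k = X k * D.stateMatrix ψ k := by
  have hU : D.U *ᵥ (A *ᵥ ψ) = blockMatrix D.q D.j D.dim_eq X *ᵥ (D.U *ᵥ ψ) := by
    rw [h, Matrix.mulVec_mulVec, Matrix.mulVec_mulVec, mul_assoc, conjTranspose_mul_U, mul_one]
  ext b a
  rw [stateMatrix, Matrix.of_apply, hU, blockMatrix_mulVec, Matrix.mul_apply]
  rfl

/-- `ψ ↦ (M_k)_k` as a linear map. -/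
noncomputable def stateMatrixLinearMap :
    (Fin d → ℂ) →ₗ[ℂ] (∀ k, Matrix (Fin (D.q k)) (Fin (D.j k)) ℂ) where
  toFun ψ k := D.stateMatrix ψ k
  map_add' ψ φ := by
    funext k
    ext b a
    simp [stateMatrix, Matrix.mulVec_add]
  map_smul' c ψ := by
    funext k
    ext b a
    simp [stateMatrix, Matrix.mulVec_smul]

theorem stateMatrixLinearMap_injective : Function.Injective D.stateMatrixLinearMap := by
  intro ψ φ h
  have hU : D.U *ᵥ ψ = D.U *ᵥ φ := by
    funext i
    obtain ⟨⟨k, a, b⟩, rfl⟩ := (blockEquiv D.q D.j D.dim_eq).surjective i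
    exact congr($h k b a)
  simpa [D.conjTranspose_mul_U] using congrArg (D.Uᴴ *ᵥ ·) hU

theorem finrank_orbit (ψ : Fin d → ℂ) :
    Module.finrank ℂ (orbit 𝒜 ψ) = ∑ k, D.q k * (D.stateMatrix ψ k).rank := by
  have hmap : (orbit 𝒜 ψ).map D.stateMatrixLinearMap = LinearMap.range
      (LinearMap.piMap fun k => mulRightLinearMap (Fin (D.q k)) ℂ (D.stateMatrix ψ k)) := by
    ext Y
    constructor
    · rintro ⟨_, ⟨A, hA, rfl⟩, rfl⟩
      obtain ⟨X, hX⟩ := (D.mem_iff A).1 hA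
      exact ⟨X, funext fun k => (D.stateMatrix_mulVec hX ψ k).symm⟩
    · rintro ⟨X, rfl⟩
      have hX : blockMatrix D.q D.j D.dim_eq X =
          D.U * (D.Uᴴ * blockMatrix D.q D.j D.dim_eq X * D.U) * D.Uᴴ := by
        calc blockMatrix D.q D.j D.dim_eq X
            = (D.U * D.Uᴴ) * blockMatrix D.q D.j D.dim_eq X * (D.U * D.Uᴴ) := by
              rw [U_mul_conjTranspose, one_mul, mul_one]
          _ = _ := by simp only [mul_assoc]
      exact ⟨_, ⟨_, (D.mem_iff _).2 ⟨X, hX⟩, rfl⟩, funext fun k => D.stateMatrix_mulVec hX ψ k⟩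
  rw [((orbit 𝒜 ψ).equivMapOfInjective _ D.stateMatrixLinearMap_injective).finrank_eq, hmap,
    LinearMap.finrank_range_piMap]
  simp only [Matrix.finrank_range_mul_right, Fintype.card_fin]

end FullDecomposition

/-! ### The algebra of a Hamiltonian model -/

namespace HamiltonianModel

variable {d M : ℕ} (H : HamiltonianModel d M)

/-- The linear part of a Hamiltonian model as a linear map. -/
noncomputable def linearPartHom : (Fin M → ℝ) →ₗ[ℝ] Matrix (Fin d) (Fin d) ℂ where
  toFun := H.linearPart
  map_add' l l' := by simp [linearPart, add_smul, Finset.sum_add_distrib]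
  map_smul' c l := by simp [linearPart, Finset.smul_sum, mul_smul]

/-- The Hamiltonian `H(l)` as an affine map of `l`. -/
noncomputable def valueHom : (Fin M → ℝ) →ᵃ[ℝ] Matrix (Fin d) (Fin d) ℂ :=
  AffineMap.const ℝ _ H.free + H.linearPartHom.toAffineMap

theorem value_eq_add_linearPart_sub (l l' : Fin M → ℝ) :
    H.value l = H.value l' + H.linearPart (l - l') := by
  have h : H.linearPart (l - l') = H.linearPart l - H.linearPart l' := H.linearPartHom.map_sub l l'
  rw [h, value, value]
  abel

theorem isHermitian_linearPart (l : Fin M → ℝ) : (H.linearPart l).IsHermitian := by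
  rw [Matrix.IsHermitian, linearPart, Matrix.conjTranspose_sum]
  refine Finset.sum_congr rfl fun k _ => ?_
  rw [Matrix.conjTranspose_smul, (H.term_isHermitian k).eq, Complex.star_def, Complex.conj_ofReal]

theorem isHermitian_value (l : Fin M → ℝ) : (H.value l).IsHermitian :=
  H.free_isHermitian.add (H.isHermitian_linearPart l)

variable {H}

theorem IsCoeff.opAlgebra_eq {S : Set (Matrix (Fin d) (Fin d) ℂ)} (hS : H.IsCoeff S) :
    opAlgebra S = Algebra.adjoin ℂ (Set.range H.value) := by
  have hval : ∀ l, H.value l ∈ Algebra.adjoin ℂ (Set.range H.value) := fun l =>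
    Algebra.subset_adjoin ⟨l, rfl⟩
  apply le_antisymm
  · refine Algebra.adjoin_le ?_
    rcases hS with ⟨b, rfl⟩ | ⟨b, i₀, -, rfl⟩
    · rintro _ ⟨i, rfl⟩
      exact hval _
    · rintro _ (rfl | ⟨i, rfl⟩)
      · exact hval _
      · have h := H.value_eq_add_linearPart_sub (b i) 0
        rw [sub_zero, ← sub_eq_iff_eq_add'] at h
        change H.linearPart (b i) ∈ _
        rw [← h]
        exact Subalgebra.sub_mem _ (hval _) (hval _)
  · refine Algebra.adjoin_le ?_
    rintro _ ⟨l, rfl⟩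
    let 𝒱 : Submodule ℝ (Matrix (Fin d) (Fin d) ℂ) :=
      (Subalgebra.toSubmodule (opAlgebra S)).restrictScalars ℝ
    change H.value l ∈ 𝒱
    have hmem : ∀ A ∈ S, A ∈ 𝒱 := fun A hA => Algebra.subset_adjoin hA
    rcases hS with ⟨b, rfl⟩ | ⟨b, i₀, hb, rfl⟩
    -- An affine map preserves the barycentric coordinates of `l`.
    · have hl : H.valueHom l = ∑ i, b.coord i l • H.valueHom (b i) := by
        conv_lhs => rw [← b.affineCombination_coord_eq_self l]
        rw [Finset.map_affineCombination _ _ _ (b.sum_coord_apply_eq_one l),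
          Finset.affineCombination_eq_linear_combination _ _ _ (b.sum_coord_apply_eq_one l)]
        rfl
      have hl' : H.value l = ∑ i, b.coord i l • H.value (b i) := hl
      rw [hl']
      exact 𝒱.sum_mem fun i _ => 𝒱.smul_mem _ (hmem _ ⟨i, rfl⟩)
    · rw [H.value_eq_add_linearPart_sub l (b i₀)]
      refine 𝒱.add_mem (hmem _ (Set.mem_insert _ _)) ?_
      have hspan : Submodule.span ℝ (Set.range fun i : {i // i ≠ i₀} => b i) = ⊤ :=
        hb.span_eq_top_of_card_eq_finrank' (by simp)
      have hle : (⊤ : Submodule ℝ (Fin M → ℝ)) ≤ 𝒱.comap H.linearPartHom := by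
        rw [← hspan, Submodule.span_le]
        rintro _ ⟨i, rfl⟩
        exact hmem _ (Set.mem_insert_of_mem _ ⟨i, rfl⟩)
      exact hle (Submodule.mem_top (x := l - b i₀))

variable (H) in
theorem conjTranspose_mem_adjoin {A : Matrix (Fin d) (Fin d) ℂ}
    (hA : A ∈ Algebra.adjoin ℂ (Set.range H.value)) :
    Aᴴ ∈ Algebra.adjoin ℂ (Set.range H.value) := by
  induction hA using Algebra.adjoin_induction with
  | mem A hA =>
    obtain ⟨l, rfl⟩ := hA
    rw [(H.isHermitian_value l).eq]
    exact Algebra.subset_adjoin ⟨l, rfl⟩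
  | algebraMap c =>
    rw [← Matrix.star_eq_conjTranspose, ← algebraMap_star_comm]
    exact Subalgebra.algebraMap_mem _ _
  | add A B _ _ hA hB =>
    rw [Matrix.conjTranspose_add]
    exact add_mem hA hB
  | mul A B _ _ hA hB =>
    rw [Matrix.conjTranspose_mul]
    exact mul_mem hB hA

variable (H) in
theorem isLeast_orbit_adjoin (ψ : Fin d → ℂ) :
    IsLeast {V : Submodule ℂ (Fin d → ℂ) | H.IsInvariant V ∧ ψ ∈ V}
      (orbit (Algebra.adjoin ℂ (Set.range H.value)) ψ) := by
  refine ⟨⟨?_, 1, one_mem _, Matrix.one_mulVec ψ⟩, ?_⟩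
  · rintro l _ ⟨A, hA, rfl⟩
    exact ⟨H.value l * A, mul_mem (Algebra.subset_adjoin ⟨l, rfl⟩) hA,
      (Matrix.mulVec_mulVec _ _ _).symm⟩
  · rintro V ⟨hV, hψ⟩ _ ⟨A, hA, rfl⟩
    suffices h : ∀ v ∈ V, A *ᵥ v ∈ V from h ψ hψ
    induction hA using Algebra.adjoin_induction with
    | mem A hA =>
      obtain ⟨l, rfl⟩ := hA
      exact hV l
    | algebraMap c =>
      intro v hv
      rw [Algebra.algebraMap_eq_smul_one, Matrix.smul_mulVec, Matrix.one_mulVec]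
      exact V.smul_mem c hv
    | add A B _ _ hA hB =>
      intro v hv
      rw [Matrix.add_mulVec]
      exact V.add_mem (hA v hv) (hB v hv)
    | mul A B _ _ hA hB =>
      intro v hv
      rw [← Matrix.mulVec_mulVec]
      exact hA _ (hB v hv)

end HamiltonianModel

theorem mainTheorem2 {d M : ℕ} (H : HamiltonianModel d M)
    (S : Set (Matrix (Fin d) (Fin d) ℂ)) (hS : H.IsCoeff S) (ψ₀ : Fin d → ℂ) :
    IsLeast {V : Submodule ℂ (Fin d → ℂ) | H.IsInvariant V ∧ ψ₀ ∈ V} (orbit (opAlgebra S) ψ₀) ∧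
    Nonempty (FullDecomposition (opAlgebra S)) ∧
    ∀ D : FullDecomposition (opAlgebra S),
      D.m = Module.finrank ℂ (Subalgebra.center ℂ (opAlgebra S)) ∧
      Module.finrank ℂ (orbit (opAlgebra S) ψ₀) = ∑ k, D.q k * (D.stateMatrix ψ₀ k).rank := by
  refine ⟨?_, ?_, fun D => ⟨D.m_eq_finrank_center, D.finrank_orbit ψ₀⟩⟩
  · rw [hS.opAlgebra_eq]
    exact H.isLeast_orbit_adjoin ψ₀
  · refine FullDecomposition.nonempty_of_conjTranspose_mem _ fun A hA => ?_
    rw [hS.opAlgebra_eq] at hA ⊢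
    exact H.conjTranspose_mem_adjoin hA
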